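/- Let $\Gamma$ be a countable discrete group acting continuously on a compact metrizable space $X$. Let $\mathcal M(X)$ be the space of Borel probability measures on $X$ with the weak$^*$-topology, a compact metrizable convex subset of $C(X)^*$, where $C(X)$ is the space of continuous functions $X\to\mathbb R$; $\Gamma$ acts continuously on $\mathcal M(X)$ by push-forward. We regard $X\subseteq\mathcal M(X)$ via $x\mapsto\delta_x$, and hence $X^k\subseteq\mathcal M(X)^k\subseteq (C(X)^*)^k$. For a continuous action of $\Gamma$ on a compact metrizable space $Y$, a $\Gamma$-invariant Borel probability measure $\nu$ on $Y$, and an integer $k\ge 1$, define $\mathrm{IN}^\nu_k(Y)\subseteq Y^k$ as follows. * For subsets $A_1,\dots,A_k$ of $Y$ and a family $D=(D_s)_{s\in\Gamma}$ of subsets of $Y$, a nonempty finite set $J\subseteq\Gamma$ is an independence set for $(A_1,\dots,A_k)$ relative to $D$ if $\bigcap_{s\in J}\bigl(D_s\cap s^{-1}A_{\sigma(s)}\bigr)\ne\emptyset$ for every map $\sigma:J\to\{1,\dots,k\}$. * The tuple $(A_1,\dots,A_k)$ has positive sequential $\nu$-independence density if there are $\delta,c>0$ such that for every $M>0$ there is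 a nonempty finite set $F\subseteq\Gamma$ with $|F|\ge M$ so that, for every family $D=(D_s)_{s\in\Gamma}$ of Borel subsets of $Y$ with $\nu(D_s)\ge 1-\delta$ for all $s\in\Gamma$, there is an independence set $J\subseteq F$ for $(A_1,\dots,A_k)$ relative to $D$ with $|J|\ge c|F|$. * $\mathrm{IN}^\nu_k(Y)$ is the set of all $(y_1,\dots,y_k)\in Y^k$ such that, whenever $U_j$ is a neighborhood of $y_j$ for $j=1,\dots,k$, the tuple $(U_1,\dots,U_k)$ has positive sequential $\nu$-independence density. **Theorem.** Let $m$ be a $\Gamma$-invariant Borel probability measure on $\mathcal M(X)$ and let $\mu\in\mathcal M(X)$ be its barycenter, i.e. $\phi(\mu)=\int_{\mathcal M(X)}\phi(\nu)\,dm(\nu)$ for every weak$^*$-continuous linear functional $\phi$ on $C(X)^*$ (the measure $\mu$ is then $\Gamma$-invariant). For every integer $k\ge 1$: 1. $\mathrm{IN}^m_k(\mathcal M(X))$ is contained in the closed convex hull of $\mathrm{IN}^\mu_k(X)$ in $\mathcal M(X)^k$. 2. $\mathrm{IN}^m_k(\mathcal M(X))\cap X^k\subseteq\mathrm{IN}^\mu_k(X)$.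 -/

import Mathlib

open MeasureTheory Set Filter Topology

noncomputable section

namespace MeasureIN

/-! ### The space of Borel probability measures -/

section ProbabilityMeasures

variable {X : Type*} [TopologicalSpace X] [MeasurableSpace X] [BorelSpace X]

/-- The weak* topology on `ProbabilityMeasure X` is generated by the conditions `∫ f dν ∈ U`. -/
theorem topology_eq_generateFrom :
    (inferInstance : TopologicalSpace (ProbabilityMeasure X)) =
      TopologicalSpace.generateFrom
        {A | ∃ (f : BoundedContinuousFunction X NNReal) (U : Set NNReal), IsOpen U ∧
          A = (fun ν : ProbabilityMeasure X => ν.toFiniteMeasure.testAgainstNN f) ⁻¹' U} := by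
  apply le_antisymm
  · apply le_generateFrom
    rintro A ⟨f, U, hU, rfl⟩
    exact hU.preimage (ProbabilityMeasure.continuous_testAgainstNN_eval f)
  · have h : @Continuous _ _ (TopologicalSpace.generateFrom
        {A | ∃ (f : BoundedContinuousFunction X NNReal) (U : Set NNReal), IsOpen U ∧
          A = (fun ν : ProbabilityMeasure X => ν.toFiniteMeasure.testAgainstNN f) ⁻¹' U}) _
        (fun ν : ProbabilityMeasure X => ν) := by
      refine @continuous_induced_rng _ _ _ _ _ _ (_) |>.2 ?_
      refine @continuous_induced_rng _ _ _ _ _ _ (_) |>.2 ?_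
      refine @WeakBilin.continuous_of_continuous_eval _ _ _ _ _ _ _ _ _ _ _ (_) _ fun f => ?_
      refine (@continuous_def _ _ (_) _ _).2 fun U hU => ?_
      exact TopologicalSpace.isOpen_generateFrom_of_mem ⟨f, U, hU, rfl⟩
    exact continuous_id_iff_le.1 h

variable [CompactSpace X]

/-- For compact metrizable `X`, the measurable structure which Mathlib puts on
`ProbabilityMeasure X` is the Borel σ-algebra of the weak* topology. -/
instance instBorelSpaceProbabilityMeasure [TopologicalSpace.MetrizableSpace X] :
    BorelSpace (ProbabilityMeasure X) := by
  let : MetricSpace X := TopologicalSpace.metrizableSpaceMetric X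
  have : SecondCountableTopology (ProbabilityMeasure X) := by
    let : MetricSpace (ProbabilityMeasure X) :=
      TopologicalSpace.metrizableSpaceMetric (ProbabilityMeasure X)
    infer_instance
  constructor
  apply le_antisymm
  · -- evaluation at a Borel set is Borel
    have key : @Measurable (ProbabilityMeasure X) (Measure X) (borel _) _
        (fun ν => (ν : Measure X)) := by
      let : MeasurableSpace (ProbabilityMeasure X) := borel _
      have : BorelSpace (ProbabilityMeasure X) := ⟨rfl⟩
      refine Measurable.measure_of_isPiSystem_of_isProbabilityMeasure
        (S := {s | IsOpen s}) (BorelSpace.measurable_eq) isPiSystem_isOpen ?_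
      intro U hU
      have hl : LowerSemicontinuous (fun ν : ProbabilityMeasure X => (ν : Measure X) U) := by
        intro ν
        refine lowerSemicontinuousAt_iff_le_liminf.2 ?_
        exact ProbabilityMeasure.le_liminf_measure_open_of_tendsto (L := 𝓝 ν) (μ := ν)
          (μs := id) tendsto_id hU
      exact hl.measurable
    exact Measurable.comap_le key
  · -- the weak* open sets are generated by countably many conditions on integrals
    rw [borel_eq_generateFrom_of_subbasis topology_eq_generateFrom]
    refine MeasurableSpace.generateFrom_le ?_
    rintro A ⟨f, U, hU, rfl⟩
    refine (?_ : Measurable (fun ν : ProbabilityMeasure X =>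
      ν.toFiniteMeasure.testAgainstNN f)) hU.measurableSet
    refine Measurable.ennreal_toNNReal ?_
    have hf : Measurable (fun x => (f x : ENNReal)) := f.continuous.measurable.coe_nnreal_ennreal
    exact (Measure.measurable_lintegral hf).comp measurable_subtype_coe

/-- A Borel probability measure on `X`, viewed as the functional `f ↦ ∫ f dν` in the dual of
`C(X, ℝ)`, which carries the weak* topology. -/
def toDual (ν : ProbabilityMeasure X) : WeakDual ℝ C(X, ℝ) :=
  StrongDual.toWeakDual <|
    LinearMap.mkContinuous
      { toFun := fun f => ∫ x, f x ∂(ν : Measure X)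
        map_add' := fun f g => integral_add
          (f.continuous.integrable_of_hasCompactSupport (HasCompactSupport.of_compactSpace _))
          (g.continuous.integrable_of_hasCompactSupport (HasCompactSupport.of_compactSpace _))
        map_smul' := fun c f => integral_const_mul c f }
      1
      (fun f => by
        have h := norm_integral_le_of_norm_le_const (μ := (ν : Measure X))
          (Eventually.of_forall fun x => f.norm_coe_le_norm x)
        simpa using h)

@[simp]
theorem toDual_apply (ν : ProbabilityMeasure X) (f : C(X, ℝ)) :
    toDual ν f = ∫ x, f x ∂(ν : Measure X) := rfl

/-- The inclusion of the `k`-fold power of the space of probability measures in the `k`-fold power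
of the weak* dual of `C(X, ℝ)`. -/
def tupleToDual {k : ℕ} (ν : Fin k → ProbabilityMeasure X) : Fin k → WeakDual ℝ C(X, ℝ) :=
  fun j => toDual (ν j)

/-- `x ↦ δ_x` in each coordinate. -/
def diracTuple {k : ℕ} (x : Fin k → X) : Fin k → ProbabilityMeasure X :=
  fun j => diracProba (x j)

/-- `μ` is the barycenter of the Borel probability measure `m` on the space of Borel probability
measures on `X`, a compact convex subset of the weak* dual of `C(X, ℝ)`: for every
(weak*-)continuous linear functional `φ`, the integral of `φ` with respect to `m` is `φ μ`. -/
def IsBarycenter (m : ProbabilityMeasure (ProbabilityMeasure X)) (μ : ProbabilityMeasure X) :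
    Prop :=
  ∀ φ : WeakDual ℝ C(X, ℝ) →L[ℝ] ℝ,
    ∫ ν, φ (toDual ν) ∂(m : Measure (ProbabilityMeasure X)) = φ (toDual μ)

end ProbabilityMeasures

/-! ### The induced action on probability measures -/

/-- The induced action of `Γ` on probability measures by push-forward. -/
instance instMulActionProbabilityMeasure {Γ X : Type*} [Group Γ] [MeasurableSpace X]
    [MulAction Γ X] [MeasurableConstSMul Γ X] : MulAction Γ (ProbabilityMeasure X) where
  smul s ν := ν.map (f := fun x => s • x) (measurable_const_smul s).aemeasurable
  one_smul ν := by
    apply Subtype.ext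
    change Measure.map (fun x : X => (1 : Γ) • x) (ν : Measure X) = ν
    simp
  mul_smul s t ν := by
    apply Subtype.ext
    change Measure.map (fun x : X => (s * t) • x) (ν : Measure X) =
      Measure.map (fun x : X => s • x) (Measure.map (fun x : X => t • x) (ν : Measure X))
    rw [Measure.map_map (measurable_const_smul s) (measurable_const_smul t)]
    congr 1
    funext x
    exact mul_smul s t x

theorem coe_smul {Γ X : Type*} [Group Γ] [MeasurableSpace X] [MulAction Γ X]
    [MeasurableConstSMul Γ X] (s : Γ) (ν : ProbabilityMeasure X) :
    ((s • ν : ProbabilityMeasure X) : Measure X) =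
      Measure.map (fun x => s • x) (ν : Measure X) := rfl

/-! ### Measure IN-tuples -/

section INTuples

variable (Γ : Type*) {Y : Type*} [SMul Γ Y] {k : ℕ}

variable {Γ} in
/-- The nonempty finite set `F ⊆ Γ` is an independence set for the tuple `A = (A₁, …, A_k)`
relative to `D : Γ → 2^Y`: for every `σ : F → [k]`, the intersection of the sets
`D_s ∩ s⁻¹ A_{σ(s)}` over `s ∈ F` is nonempty. -/
def IsIndepSetRel (A : Fin k → Set Y) (D : Γ → Set Y) (F : Finset Γ) : Prop :=
  F.Nonempty ∧ ∀ σ : F → Fin k,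
    (⋂ s : F, D (s : Γ) ∩ (fun y : Y => (s : Γ) • y) ⁻¹' A (σ s)).Nonempty

/-- The families `D` of Borel sets indexed by `Γ` with `μ (D s) ≥ 1 - δ` for all `s`. -/
def largeFamilies [MeasurableSpace Y] (μ : ProbabilityMeasure Y) (δ : ℝ) : Set (Γ → Set Y) :=
  {D | (∀ s, MeasurableSet (D s)) ∧ ∀ s, 1 - δ ≤ (μ : Measure Y).real (D s)}

/-- The tuple `A` has positive sequential `μ`-independence density. -/
def HasPosSeqIndepDensity [MeasurableSpace Y] (μ : ProbabilityMeasure Y) (A : Fin k → Set Y) :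
    Prop :=
  ∃ δ : ℝ, 0 < δ ∧ ∃ c : ℝ, 0 < c ∧ ∀ M : ℝ, 0 < M →
    ∃ F : Finset Γ, F.Nonempty ∧ M ≤ (F.card : ℝ) ∧
      ∀ D ∈ largeFamilies Γ μ δ, ∃ J : Finset Γ, J ⊆ F ∧ IsIndepSetRel A D J ∧
        c * (F.card : ℝ) ≤ (J.card : ℝ)

variable (k) in
/-- The set of `μ`-IN-tuples of length `k`. -/
def measureIN [TopologicalSpace Y] [MeasurableSpace Y] (μ : ProbabilityMeasure Y) :
    Set (Fin k → Y) :=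
  {y | ∀ U : Fin k → Set Y, (∀ j, U j ∈ 𝓝 (y j)) → HasPosSeqIndepDensity Γ μ U}

end INTuples

end MeasureIN

end

/-! Everything reduces to one inequality (`exists_mem_measureIN_le_sum`): if `ν` is an IN-tuple for
`m` and `u < ∑ ∫ f_j dν_j`, then some IN-tuple `y` for `μ` has `u ≤ ∑ f_j (y_j)`. Weak*-continuous
functionals on the `k`-fold product have the form `w ↦ ∑ w_j (f_j)`, so Hahn–Banach gives the convex
hull statement. For Dirac tuples, bump functions `f_j` force `y_j` into the prescribed
neighborhoods.

For the inequality, take a family `D` in `X` of almost full `μ`-measure. By Markov, most measures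
give each `D_s` almost full mass, so independence at the level of measures provides a `ν_σ` for
every `σ : J → Fin k`. A first moment argument replaces `ν_σ` by a point `x_σ` at which `f_{σ(s)} (s
x_σ)` is large on average over `s` and `x_σ ∈ D_s` for most `s`. Recording `s x_σ` by the nearby
point of a finite net, with an extra letter for `x_σ ∉ D_s`, gives words indexed by `σ`.

The combinatorial core (`exists_independent_selection`) extracts from these words one tuple `p` of
letters with large total value and a subset of `J` of positive proportion on which all patterns of
`p` occur. If every such `p` failed, a Sauer–Shelah type covering would split all `σ` into
subexponentially many classes, each exponentially small relative to `k^|J|` by a Chernoff bound.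
Compactness of `X^k` then turns the balls around net points into an IN-tuple. -/

namespace MeasureIN

/-! ### Shattering by partial functions -/

section Shattering

universe u

variable {α ι : Type*}

/-- The family `S` of partial functions shatters `W`: every function on `W` is induced by a member
of `S`. -/
def Shatters (S : Set (α → Option ι)) (W : Finset α) : Prop :=
  ∀ τ : α → ι, ∃ θ ∈ S, ∀ s ∈ W, θ s = some (τ s)

theorem Shatters.mono {S S' : Set (α → Option ι)} {W : Finset α} (h : Shatters S W)
    (hS : S ⊆ S') : Shatters S' W := fun τ =>
  let ⟨θ, hθ, hW⟩ := h τ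
  ⟨θ, hS hθ, hW⟩

variable [Fintype ι] [DecidableEq α]

open Classical in
/-- The number of subsets of `T` shattered by `S`, a subset with `j` elements being counted with
weight `(|ι| - 1)⁻ʲ`. -/
noncomputable def shatterWeight (S : Set (α → Option ι)) (T : Finset α) : ℝ :=
  ∑ W ∈ T.powerset, if Shatters S W then (((Fintype.card ι : ℝ) - 1)⁻¹) ^ W.card else 0

omit [DecidableEq α] in
theorem shatterWeight_nonneg (hι : 2 ≤ Fintype.card ι) (S : Set (α → Option ι)) (T : Finset α) :
    0 ≤ shatterWeight S T := by
  have : (2 : ℝ) ≤ Fintype.card ι := by exact_mod_cast hι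
  refine Finset.sum_nonneg fun W _ => ?_
  split_ifs
  · exact pow_nonneg (inv_nonneg.2 (by linarith)) _
  · rfl

omit [DecidableEq α] in
theorem shatterWeight_mono (hι : 2 ≤ Fintype.card ι) (S : Set (α → Option ι)) {T T' : Finset α}
    (h : T ⊆ T') : shatterWeight S T ≤ shatterWeight S T' := by
  have : (2 : ℝ) ≤ Fintype.card ι := by exact_mod_cast hι
  refine Finset.sum_le_sum_of_subset_of_nonneg (Finset.powerset_mono.2 h) fun W _ _ => ?_
  split_ifs
  · exact pow_nonneg (inv_nonneg.2 (by linarith)) _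
  · rfl

/-- Compare the contributions of each `W ⊆ T`. If all `|ι|` fibres over `s` shatter `W`, then `S`
shatters both `W` and `insert s W`, and the weight is chosen so that these two terms balance
exactly. Otherwise at most `|ι| - 1` fibres do, and the term of `W` alone suffices. -/
theorem sum_shatterWeight_le (hι : 2 ≤ Fintype.card ι) (S : Set (α → Option ι)) {T : Finset α}
    {s : α} (hs : s ∉ T) :
    ∑ a, shatterWeight {θ ∈ S | θ s = some a} T ≤
      ((Fintype.card ι : ℝ) - 1) * shatterWeight S (insert s T) := by
  classical
  have h2 : (2 : ℝ) ≤ Fintype.card ι := by exact_mod_cast hι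
  set q : ℝ := (Fintype.card ι : ℝ) - 1 with hq
  have hq0 : 0 < q := by linarith
  unfold shatterWeight
  rw [Finset.sum_comm, Finset.sum_powerset_insert hs, ← Finset.sum_add_distrib, Finset.mul_sum]
  refine Finset.sum_le_sum fun W hW => ?_
  have hsW : s ∉ W := fun h => hs (Finset.mem_powerset.1 hW h)
  rw [← hq, Finset.card_insert_of_notMem hsW]
  have hw : 0 < (q⁻¹) ^ W.card := pow_pos (inv_pos.2 hq0) _
  rw [← Finset.sum_filter, Finset.sum_const, nsmul_eq_mul, mul_add]
  by_cases hall : ∀ a, Shatters {θ ∈ S | θ s = some a} W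
  · have h1 : Shatters S (insert s W) := by
      intro τ
      obtain ⟨θ, hθ, hW'⟩ := hall (τ s) τ
      refine ⟨θ, hθ.1, fun x hx => ?_⟩
      rcases Finset.mem_insert.1 hx with rfl | hx
      · exact hθ.2
      · exact hW' x hx
    have h0 : Shatters S W := fun τ =>
      let ⟨θ, hθ, h⟩ := h1 τ
      ⟨θ, hθ, fun x hx => h x (Finset.mem_insert_of_mem hx)⟩
    rw [if_pos h1, if_pos h0, Finset.filter_true_of_mem fun a _ => hall a, Finset.card_univ,
      pow_succ]
    have : q * ((q⁻¹) ^ W.card * q⁻¹) = (q⁻¹) ^ W.card := by field_simp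
    rw [this]
    apply le_of_eq
    rw [hq]
    ring
  · push Not at hall
    obtain ⟨b, hb⟩ := hall
    have hnn : 0 ≤ q * (if Shatters S (insert s W) then (q⁻¹) ^ (W.card + 1) else 0) := by
      split_ifs
      · positivity
      · simp
    refine le_trans ?_ (le_add_of_nonneg_right hnn)
    by_cases h0 : Shatters S W
    · rw [if_pos h0]
      refine mul_le_mul_of_nonneg_right ?_ hw.le
      have hlt : (Finset.univ.filter fun a => Shatters {θ ∈ S | θ s = some a} W).card
          < Fintype.card ι := by
        rw [← Finset.card_univ]
        exact Finset.card_lt_card (Finset.filter_ssubset.2 ⟨b, Finset.mem_univ _, hb⟩)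
      have : ((Finset.univ.filter fun a => Shatters {θ ∈ S | θ s = some a} W).card : ℝ) + 1
          ≤ Fintype.card ι := by exact_mod_cast hlt
      linarith
    · rw [Finset.filter_false_of_mem fun a _ h => h0 (h.mono fun θ hθ => hθ.1)]
      simp [h0]

/-- A family of partial functions is covered by few boxes, each of which omits one value in every
coordinate, if it shatters few sets. -/
theorem exists_cover_card_le (hι : 2 ≤ Fintype.card ι) {t : ℝ} (ht : 0 < t) {C : ℕ}
    (hC : 1 + 1 / t ≤ ((Fintype.card ι : ℝ) / (Fintype.card ι - 1)) ^ C) (T : Finset α) :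
    ∀ S : Set (α → Option ι), ∃ Z : Finset (α → ι),
      (Z.card : ℝ) ≤ (1 + t) ^ T.card * shatterWeight S T ^ C ∧
        ∀ θ ∈ S, ∃ z ∈ Z, ∀ s ∈ T, θ s ≠ some (z s) := by
  classical
  have h2 : (2 : ℝ) ≤ Fintype.card ι := by exact_mod_cast hι
  have : Nontrivial ι := Fintype.one_lt_card_iff_nontrivial.1 hι
  induction T using Finset.induction_on with
  | empty =>
    intro S
    by_cases hS : S.Nonempty
    · refine ⟨{fun _ => Classical.arbitrary ι}, ?_, by simp⟩
      have : Shatters S ∅ := fun τ => ⟨hS.some, hS.some_mem, by simp⟩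
      simp [shatterWeight, this]
    · rw [not_nonempty_iff_eq_empty.1 hS]
      refine ⟨∅, ?_, by simp⟩
      have := shatterWeight_nonneg hι (∅ : Set (α → Option ι)) ∅
      simp only [Finset.card_empty, Nat.cast_zero, pow_zero, one_mul]
      positivity
  | insert s T hs ih =>
    intro S
    -- Boxes omitting `a` at `s` handle every `θ` with `θ s ≠ some a`; the fibre over `a` needs
    -- boxes omitting some `b ≠ a`. Taking `a` of least weight makes the weight of that fibre
    -- smaller than the new weight by the factor `(|ι| - 1) / |ι|`.
    obtain ⟨a, -, ha⟩ := Finset.exists_min_image Finset.univ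
      (fun a => shatterWeight {θ ∈ S | θ s = some a} T) Finset.univ_nonempty
    obtain ⟨b, hb⟩ := exists_ne a
    obtain ⟨Z, hZ, hZc⟩ := ih S
    obtain ⟨Z', hZ', hZc'⟩ := ih {θ ∈ S | θ s = some a}
    refine ⟨Z.image (Function.update · s a) ∪ Z'.image (Function.update · s b), ?_, ?_⟩
    · set x := shatterWeight {θ ∈ S | θ s = some a} T with hx
      set y := shatterWeight S T with hy
      set w := shatterWeight S (insert s T) with hw
      have hx0 : 0 ≤ x := shatterWeight_nonneg hι _ _
      have hy0 : 0 ≤ y := shatterWeight_nonneg hι _ _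
      have hw0 : 0 ≤ w := shatterWeight_nonneg hι _ _
      have hyw : y ≤ w := shatterWeight_mono hι S (Finset.subset_insert s T)
      have hxw : (Fintype.card ι : ℝ) / (Fintype.card ι - 1) * x ≤ w := by
        have h1 := sum_shatterWeight_le hι S hs
        have h3 : (Fintype.card ι : ℝ) * x ≤ ∑ a, shatterWeight {θ ∈ S | θ s = some a} T := by
          rw [← nsmul_eq_mul, ← Finset.card_univ]
          exact Finset.card_nsmul_le_sum _ _ _ fun c _ => ha c (Finset.mem_univ c)
        rw [div_mul_eq_mul_div, div_le_iff₀ (by linarith)]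
        linarith
      have hcard : ((Z.image (Function.update · s a) ∪
          Z'.image (Function.update · s b)).card : ℝ) ≤ Z.card + Z'.card := by
        exact_mod_cast (Finset.card_union_le _ _).trans
          (add_le_add Finset.card_image_le Finset.card_image_le)
      have hp : (0 : ℝ) < (1 + t) ^ T.card := by positivity
      rw [Finset.card_insert_of_notMem hs, pow_succ]
      refine hcard.trans ((add_le_add hZ hZ').trans ?_)
      rw [← mul_add, mul_assoc]
      refine mul_le_mul_of_nonneg_left ?_ hp.le
      -- Either the fibre adds at most a proportion `t`, paid for by the factor `1 + t`, or `y ^ C`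
      -- is at most `x ^ C / t` and the gain `(|ι| / (|ι| - 1)) ^ C ≥ 1 + 1 / t` absorbs both terms.
      rcases le_or_gt (x ^ C) (t * y ^ C) with h | h
      · have := pow_le_pow_left₀ hy0 hyw C
        nlinarith
      · have h4 : (1 + 1 / t) * x ^ C ≤ w ^ C := by
          refine le_trans ?_ (pow_le_pow_left₀ (by
            have : (0 : ℝ) < Fintype.card ι - 1 := by linarith
            positivity) hxw C)
          rw [mul_pow]
          exact mul_le_mul_of_nonneg_right hC (by positivity)
        have h5 : y ^ C ≤ 1 / t * x ^ C := by
          rw [div_mul_eq_mul_div, one_mul, le_div_iff₀ ht]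
          linarith
        have h6 : 0 ≤ w ^ C := by positivity
        nlinarith
    · intro θ hθ
      by_cases h : θ s = some a
      · obtain ⟨z, hz, hzT⟩ := hZc' θ ⟨hθ, h⟩
        refine ⟨_, Finset.mem_union_right _ (Finset.mem_image_of_mem _ hz), fun x hx => ?_⟩
        rcases Finset.mem_insert.1 hx with rfl | hxT
        · simpa [h] using hb.symm
        · rw [Function.update_of_ne (by rintro rfl; exact hs hxT)]
          exact hzT x hxT
      · obtain ⟨z, hz, hzT⟩ := hZc θ hθ
        refine ⟨_, Finset.mem_union_left _ (Finset.mem_image_of_mem _ hz), fun x hx => ?_⟩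
        rcases Finset.mem_insert.1 hx with rfl | hxT
        · simpa using h
        · rw [Function.update_of_ne (by rintro rfl; exact hs hxT)]
          exact hzT x hxT

/-- There are few subsets of small relative size. -/
theorem exists_card_small_subsets_le {ρ : ℝ} (hρ : 1 < ρ) :
    ∃ c : ℝ, 0 < c ∧ ∀ (α : Type u) (T : Finset α),
    ((T.powerset.filter fun W => (W.card : ℝ) < c * T.card).card : ℝ) ≤ ρ ^ T.card := by
  obtain ⟨x, hx0, hx1, hxρ⟩ : ∃ x : ℝ, 0 < x ∧ x < 1 ∧ 1 + x < ρ :=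
    ⟨min (1 / 2) ((ρ - 1) / 2), lt_min (by norm_num) (by linarith),
      (min_le_left _ _).trans_lt (by norm_num), by
        have := min_le_right (1 / 2 : ℝ) ((ρ - 1) / 2)
        linarith⟩
  have hl : Real.log x < 0 := Real.log_neg hx0 hx1
  have hr : 0 < Real.log (ρ / (1 + x)) := Real.log_pos ((one_lt_div (by linarith)).2 hxρ)
  refine ⟨Real.log (ρ / (1 + x)) / (-Real.log x), div_pos hr (by linarith), fun α T => ?_⟩
  set F := T.powerset.filter fun W =>
    (W.card : ℝ) < Real.log (ρ / (1 + x)) / (-Real.log x) * T.card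
  -- Since `∑ x ^ |W| = (1 + x) ^ |T|` over all `W ⊆ T`, a lower bound for each small `W` bounds
  -- their number.
  have h1 : ∀ W ∈ F, ((1 + x) / ρ) ^ T.card ≤ x ^ W.card := by
    intro W hW
    have hW := (Finset.mem_filter.1 hW).2
    rw [← Real.log_le_log_iff (by positivity) (by positivity), Real.log_pow, Real.log_pow]
    rw [div_mul_eq_mul_div, lt_div_iff₀ (by linarith)] at hW
    have : Real.log ((1 + x) / ρ) = -Real.log (ρ / (1 + x)) := by
      rw [← Real.log_inv, inv_div]
    rw [this]
    nlinarith
  have h2 : (F.card : ℝ) * ((1 + x) / ρ) ^ T.card ≤ (1 + x) ^ T.card := by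
    rw [← nsmul_eq_mul]
    refine (Finset.card_nsmul_le_sum F _ _ h1).trans ?_
    refine (Finset.sum_le_sum_of_subset_of_nonneg (Finset.filter_subset _ _)
      fun W _ _ => by positivity).trans (le_of_eq ?_)
    have := Finset.sum_pow_mul_eq_add_pow x 1 T
    simpa [add_comm] using this
  rw [div_pow, ← mul_div_assoc, div_le_iff₀ (by positivity), mul_comm] at h2
  exact le_of_mul_le_mul_left h2 (by positivity)

/-- A family of partial functions which shatters no set of positive relative size is covered by
subexponentially many boxes, each of which omits one value in every coordinate. -/
theorem exists_cover_card_le_pow {ι : Type*} [Fintype ι] (hι : 2 ≤ Fintype.card ι) {ρ : ℝ} (hρ : 1 < ρ) :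
    ∃ c : ℝ, 0 < c ∧ ∀ (α : Type u) (T : Finset α) (S : Set (α → Option ι)),
      (∀ W ⊆ T, Shatters S W → (W.card : ℝ) < c * T.card) →
      ∃ Z : Finset (α → ι), (Z.card : ℝ) ≤ ρ ^ T.card ∧
        ∀ θ ∈ S, ∃ z ∈ Z, ∀ s ∈ T, θ s ≠ some (z s) := by
  classical
  have h2 : (2 : ℝ) ≤ Fintype.card ι := by exact_mod_cast hι
  obtain ⟨t, ht, htρ⟩ : ∃ t : ℝ, 0 < t ∧ 1 + t < ρ := ⟨(ρ - 1) / 2, by linarith, by linarith⟩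
  have hb : 1 < (Fintype.card ι : ℝ) / (Fintype.card ι - 1) := by
    rw [one_lt_div (by linarith)]
    linarith
  obtain ⟨C, hC⟩ := pow_unbounded_of_one_lt (1 + 1 / t) hb
  obtain ⟨r, hr1, hr⟩ : ∃ r : ℝ, 1 < r ∧ r ^ C < ρ / (1 + t) := by
    have h1 : 1 < ρ / (1 + t) := (one_lt_div (by linarith)).2 htρ
    have hc : Tendsto (fun r : ℝ => r ^ C) (𝓝[>] 1) (𝓝 (1 ^ C)) :=
      ((continuous_pow C).tendsto 1).mono_left nhdsWithin_le_nhds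
    rw [one_pow] at hc
    obtain ⟨r, h3, h4⟩ := ((hc.eventually (gt_mem_nhds h1)).and self_mem_nhdsWithin).exists
    exact ⟨r, h4, h3⟩
  obtain ⟨c, hc, hcT⟩ := exists_card_small_subsets_le.{u} hr1
  refine ⟨c, hc, fun α T S hS => ?_⟩
  obtain ⟨Z, hZ, hZS⟩ := exists_cover_card_le hι ht hC.le T S
  refine ⟨Z, hZ.trans ?_, hZS⟩
  -- Each weight is at most 1 because `|ι| - 1 ≥ 1`, so it is enough to count the shattered sets,
  -- all of which are small.
  have hw : shatterWeight S T ≤ r ^ T.card := by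
    refine le_trans ?_ (hcT α T)
    rw [Finset.cast_card, Finset.sum_filter]
    refine Finset.sum_le_sum fun W hW => ?_
    by_cases h : Shatters S W
    · rw [if_pos h, if_pos (hS W (Finset.mem_powerset.1 hW) h)]
      refine pow_le_one₀ (inv_nonneg.2 (by linarith)) (inv_le_one_of_one_le₀ (by linarith))
    · rw [if_neg h]
      split_ifs <;> norm_num
  calc (1 + t) ^ T.card * shatterWeight S T ^ C ≤ (1 + t) ^ T.card * (r ^ T.card) ^ C := by
        have := shatterWeight_nonneg hι S T
        gcongr
    _ = ((1 + t) * r ^ C) ^ T.card := by rw [mul_pow, ← pow_mul, ← pow_mul, mul_comm C]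
    _ ≤ ρ ^ T.card := by
        rw [lt_div_iff₀ (by linarith)] at hr
        have : 0 < r := by linarith
        exact pow_le_pow_left₀ (by positivity) (by linarith) _

end Shattering

/-! ### Independent selections of letters -/

section Selection

universe u

variable {ι A : Type*} [Fintype ι] [Fintype A]

/-- If the sum of `g j (p j)` is at most `v` for all selections `p` from `B`, then the suprema of
the `g j` on the sets `B j` (or substitutes for them, if some of these sets are empty) have sum at
most `v`. -/
theorem exists_upper_bounds_sum_le (g : ι → A → ℝ) (B : ι → Set A) {v : ℝ}
    (hB : ∀ p : ι → A, (∀ j, p j ∈ B j) → ∑ j, g j (p j) ≤ v) :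
    ∃ h : ι → ℝ, (∀ j, ∀ a ∈ B j, g j a ≤ h j) ∧ ∑ j, h j ≤ v := by
  classical
  by_cases hne : ∀ j, (B j).Nonempty
  · choose p hp hmax using fun j => Set.exists_max_image (B j) (g j) (Set.toFinite _) (hne j)
    exact ⟨fun j => g j (p j), fun j a ha => hmax j a ha, hB p hp⟩
  · push Not at hne
    obtain ⟨i, hi⟩ := hne
    choose C hC using fun j => (Set.finite_range (g j)).bddAbove
    refine ⟨Function.update C i (v - ∑ j ∈ Finset.univ.erase i, C j), fun j a ha => ?_, ?_⟩
    · by_cases hj : j = i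
      · subst hj
        simp [hi] at ha
      · rw [Function.update_of_ne hj]
        exact hC j (mem_range_self a)
    -- Since `B i` is empty, the value at `i` is unconstrained and makes the total exactly `v`.
    · rw [← Finset.add_sum_erase _ _ (Finset.mem_univ i), Function.update_self,
        Finset.sum_congr rfl fun j hj => Function.update_of_ne (Finset.ne_of_mem_erase hj) _ C]
      linarith

/-- Finitely many families of real numbers with negative sums have exponential sums bounded away
from the number of terms, after a common scaling. -/
theorem exists_sum_exp_le {β : Type*} [Finite β] [Nonempty ι] (y : β → ι → ℝ)
    {ε : ℝ} (hε : 0 < ε) (hy : ∀ b, ∑ j, y b j ≤ -ε) :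
    ∃ t : ℝ, 0 < t ∧ ∃ r : ℝ, 0 < r ∧ r < 1 ∧
      ∀ b, ∑ j, Real.exp (t * y b j) ≤ Fintype.card ι * r := by
  obtain ⟨K, hK⟩ := (Set.finite_range fun x : β × ι => |y x.1 x.2|).bddAbove
  have hk : (0 : ℝ) < Fintype.card ι := by exact_mod_cast Fintype.card_pos
  set k : ℝ := (Fintype.card ι : ℝ)
  set L : ℝ := max K 1
  have hL : 0 < L := lt_max_of_lt_right one_pos
  have hyL : ∀ b j, |y b j| ≤ L := fun b j => (hK (mem_range_self (b, j))).trans (le_max_left _ _)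
  -- The three bounds give, in order: validity of `exp z ≤ 1 + z + z ^ 2`, a quadratic error of at
  -- most half the linear gain `t * ε`, and positivity of `r`.
  set t : ℝ := min (1 / L) (min (ε / (2 * k * L ^ 2)) (k / ε))
  have ht : 0 < t := by positivity
  have ht1 : t * L ≤ 1 := by
    rw [← le_div_iff₀ hL]
    exact min_le_left _ _
  have ht2 : t * (2 * k * L ^ 2) ≤ ε := by
    rw [← le_div_iff₀ (by positivity)]
    exact (min_le_right _ _).trans (min_le_left _ _)
  have ht3 : t * ε ≤ k := by
    rw [← le_div_iff₀ hε]
    exact (min_le_right _ _).trans (min_le_right _ _)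
  refine ⟨t, ht, 1 - t * ε / (2 * k), ?_, ?_, fun b => ?_⟩
  · rw [sub_pos, div_lt_one (by positivity)]
    linarith
  · have : 0 < t * ε / (2 * k) := by positivity
    linarith
  · have h1 : ∀ j, Real.exp (t * y b j) ≤ 1 + t * y b j + (t * L) ^ 2 := by
      intro j
      have h2 : |t * y b j| ≤ t * L := by
        rw [abs_mul, abs_of_pos ht]
        exact mul_le_mul_of_nonneg_left (hyL b j) ht.le
      have h3 := (le_abs_self _).trans (Real.abs_exp_sub_one_sub_id_le (h2.trans ht1))
      have h4 : (t * y b j) ^ 2 ≤ (t * L) ^ 2 := sq_le_sq' (abs_le.1 h2).1 (abs_le.1 h2).2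
      linarith
    refine (Finset.sum_le_sum fun j _ => h1 j).trans ?_
    rw [Finset.sum_add_distrib, Finset.sum_add_distrib, ← Finset.mul_sum]
    simp only [Finset.sum_const, Finset.card_univ, nsmul_eq_mul, mul_one]
    have h5 := mul_le_mul_of_nonneg_left (hy b) ht.le
    have h6 := mul_le_mul_of_nonneg_left ht2 ht.le
    have h7 : k * (1 - t * ε / (2 * k)) = k - t * ε / 2 := by field_simp
    rw [h7]
    change k + t * ∑ j, y b j + k * (t * L) ^ 2 ≤ _
    nlinarith

/-- Markov's inequality for exponential moments, in a finite product. -/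
theorem card_le_of_sum_nonneg {α : Type*} [Fintype α] (R : Finset (α → ι)) (y : α → ι → ℝ)
    {t M : ℝ} (ht : 0 ≤ t) (hy : ∀ s, ∑ j, Real.exp (t * y s j) ≤ M)
    (hR : ∀ σ ∈ R, 0 ≤ ∑ s, y s (σ s)) : (R.card : ℝ) ≤ M ^ Fintype.card α := by
  classical
  calc (R.card : ℝ) = ∑ σ ∈ R, 1 := by simp
    _ ≤ ∑ σ ∈ R, ∏ s, Real.exp (t * y s (σ s)) := by
        refine Finset.sum_le_sum fun σ hσ => ?_
        rw [← Real.exp_sum, ← Finset.mul_sum]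
        exact Real.one_le_exp (mul_nonneg ht (hR σ hσ))
    _ ≤ ∑ σ : α → ι, ∏ s, Real.exp (t * y s (σ s)) :=
        Finset.sum_le_sum_of_subset_of_nonneg (Finset.subset_univ _)
          fun σ _ _ => Finset.prod_nonneg fun s _ => (Real.exp_pos _).le
    _ = ∏ s, ∑ j, Real.exp (t * y s j) := by
        rw [Finset.prod_univ_sum, Fintype.piFinset_univ]
    _ ≤ ∏ _s : α, M := Finset.prod_le_prod
        (fun s _ => Finset.sum_nonneg fun j _ => (Real.exp_pos _).le) fun s _ => hy s
    _ = M ^ Fintype.card α := by simp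

/-- Auxiliary form of `exists_independent_selection` for index types with at least two elements. -/
theorem exists_independent_selection_of_two_le (hι : 2 ≤ Fintype.card ι) (g : ι → A → ℝ)
    (a : ι → ℝ) {ε : ℝ} (hε : 0 < ε) :
    ∃ c : ℝ, 0 < c ∧ ∀ (α : Type u) [Fintype α] [Nonempty α] (ω : (α → ι) → α → A),
      (∀ σ, ∑ s, a (σ s) ≤ ∑ s, g (σ s) (ω σ s)) →
      ∃ p : ι → A, ∑ j, a j - ε ≤ ∑ j, g j (p j) ∧
        ∃ W : Finset α, c * Fintype.card α ≤ W.card ∧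
          ∀ τ : α → ι, ∃ σ, ∀ s ∈ W, σ s = τ s ∧ ω σ s = p (τ s) := by
  classical
  have : Nonempty ι := Fintype.card_pos_iff.1 (by omega)
  have hk : (0 : ℝ) < Fintype.card ι := by exact_mod_cast Fintype.card_pos
  -- the sets of letters which admit no good selection
  let β := {B : ι → Set A // ∀ p : ι → A, (∀ j, p j ∈ B j) → ∑ j, g j (p j) ≤ ∑ j, a j - ε}
  choose h hh hs using fun B : β => exists_upper_bounds_sum_le g B.1 B.2
  obtain ⟨t, ht, r, hr0, hr1, hr⟩ := exists_sum_exp_le (fun (B : β) j => h B j - a j) hε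
    (fun B => by rw [Finset.sum_sub_distrib]; linarith [hs B])
  -- One cover is used for each tuple `p`; all of them together must not outweigh the exponential
  -- saving `r`.
  obtain ⟨ρ, hρ1, hρ⟩ : ∃ ρ : ℝ, 1 < ρ ∧ ρ ^ Fintype.card (ι → A) < 1 / r := by
    have hc : Tendsto (fun x : ℝ => x ^ Fintype.card (ι → A)) (𝓝[>] 1)
        (𝓝 (1 ^ Fintype.card (ι → A))) := ((continuous_pow _).tendsto 1).mono_left nhdsWithin_le_nhds
    rw [one_pow] at hc
    obtain ⟨x, h3, h4⟩ := ((hc.eventually (gt_mem_nhds ((one_lt_div hr0).2 hr1))).and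
      self_mem_nhdsWithin).exists
    exact ⟨x, h4, h3⟩
  obtain ⟨c, hc, hcov⟩ := exists_cover_card_le_pow.{u} hι hρ1
  refine ⟨c, hc, fun α _ _ ω hω => ?_⟩
  by_contra! hcon
  let θ : (ι → A) → (α → ι) → α → Option ι := fun p σ s =>
    if ω σ s = p (σ s) then some (σ s) else none
  have hθ : ∀ p σ s j, θ p σ s = some j ↔ σ s = j ∧ ω σ s = p j := by
    intro p σ s j
    simp only [θ]
    split_ifs with h1
    · constructor
      · intro h2
        obtain rfl : σ s = j := by simpa using h2
        exact ⟨rfl, h1⟩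
      · rintro ⟨rfl, -⟩
        rfl
    · simp only [false_iff, not_and]
      rintro rfl
      exact h1
  have hZ : ∀ p : ι → A, ∃ Z : Finset (α → ι), (Z.card : ℝ) ≤ ρ ^ Fintype.card α ∧
      ∀ σ, ∃ z ∈ Z, ∑ j, a j - ε ≤ ∑ j, g j (p j) → ∀ s, ¬ (σ s = z s ∧ ω σ s = p (z s)) := by
    intro p
    by_cases hp : ∑ j, a j - ε ≤ ∑ j, g j (p j)
    · obtain ⟨Z, hZ, hZc⟩ := hcov α Finset.univ (range (θ p)) fun W _ hW => by
        by_contra! hWc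
        obtain ⟨τ, hτ⟩ := hcon p hp W (by simpa using hWc)
        obtain ⟨_, ⟨σ, rfl⟩, hσ⟩ := hW τ
        obtain ⟨s, hsW, hns⟩ := hτ σ
        have := (hθ _ _ _ _).1 (hσ s hsW)
        exact hns this.1 this.2
      refine ⟨Z, by simpa using hZ, fun σ => ?_⟩
      obtain ⟨z, hz, hzs⟩ := hZc _ (mem_range_self σ)
      exact ⟨z, hz, fun _ s hs => hzs s (Finset.mem_univ s) ((hθ _ _ _ _).2 hs)⟩
    · refine ⟨{fun _ => Classical.arbitrary ι}, ?_, fun σ => ⟨_, Finset.mem_singleton_self _,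
        fun h => absurd h hp⟩⟩
      simpa using one_le_pow₀ hρ1.le
  choose Z hZc hZσ using hZ
  choose z hzZ hz using hZσ
  have hfib : ∀ w ∈ Fintype.piFinset Z,
      ((Finset.univ.filter fun σ : α → ι => (fun p => z p σ) = w).card : ℝ) ≤
        (Fintype.card ι * r) ^ Fintype.card α := by
    intro w _
    -- In the class `w`, these are the letters still possible at `s` when `σ s = j`. A good `p`
    -- cannot be selected from them, since it is excluded at the index `w p s`. Hence `h (B s) - a`
    -- has negative sum, although its sum along each `σ` of the class is nonnegative.
    let B : α → β := fun s => ⟨fun j => {b | ∀ p : ι → A, ∑ j, a j - ε ≤ ∑ j, g j (p j) →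
      ¬ (j = w p s ∧ b = p (w p s))}, fun p hp => by
        by_contra! hgood
        exact hp (w p s) p hgood.le ⟨rfl, rfl⟩⟩
    refine card_le_of_sum_nonneg _ (fun s j => h (B s) j - a j) ht.le (fun s => hr (B s)) ?_
    intro σ hσ
    have hσw : ∀ p, z p σ = w p := fun p => congrFun (Finset.mem_filter.1 hσ).2 p
    rw [Finset.sum_sub_distrib, sub_nonneg]
    refine (hω σ).trans (Finset.sum_le_sum fun s _ => hh (B s) (σ s) _ fun p hp => ?_)
    rw [← hσw p]
    exact hz p σ hp s
  have hcount : (Fintype.card ι : ℝ) ^ Fintype.card α ≤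
      (ρ ^ Fintype.card α) ^ Fintype.card (ι → A) * (Fintype.card ι * r) ^ Fintype.card α := by
    have h1 := Finset.card_eq_sum_card_fiberwise (s := (Finset.univ : Finset (α → ι)))
      (t := Fintype.piFinset Z) (f := fun σ p => z p σ)
      (fun σ _ => Fintype.mem_piFinset.2 fun p => hzZ p σ)
    have h2 : (Fintype.card ι : ℝ) ^ Fintype.card α = ∑ w ∈ Fintype.piFinset Z,
        ((Finset.univ.filter fun σ : α → ι => (fun p => z p σ) = w).card : ℝ) := by
      rw [Finset.card_univ, Fintype.card_fun] at h1
      exact_mod_cast h1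
    rw [h2]
    refine (Finset.sum_le_card_nsmul _ _ _ hfib).trans ?_
    rw [nsmul_eq_mul, Fintype.card_piFinset]
    refine mul_le_mul_of_nonneg_right ?_ (by positivity)
    push_cast
    refine (Finset.prod_le_prod (fun p _ => by positivity) fun p _ => hZc p).trans ?_
    simp
  have hlt : (ρ ^ Fintype.card (ι → A) * r) ^ Fintype.card α < 1 := by
    refine pow_lt_one₀ (by positivity) ?_ Fintype.card_ne_zero
    rwa [← lt_div_iff₀ hr0]
  have heq : (ρ ^ Fintype.card α) ^ Fintype.card (ι → A) * (Fintype.card ι * r) ^ Fintype.card α =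
      (Fintype.card ι : ℝ) ^ Fintype.card α *
        (ρ ^ Fintype.card (ι → A) * r) ^ Fintype.card α := by
    rw [mul_pow, mul_pow, ← pow_mul, ← pow_mul, mul_comm (Fintype.card α)]
    ring
  rw [heq] at hcount
  have : (0 : ℝ) < (Fintype.card ι : ℝ) ^ Fintype.card α := by positivity
  nlinarith

/-- If every sequence `σ` of indices admits a sequence `ω σ` of letters with
`∑ g (σ s) (ω σ s) ≥ ∑ a (σ s)`, then there is a tuple `p` of letters with
`∑ g j (p j) ≥ ∑ a j - ε` such that the sequences `ω σ` are independent along `p` on a set of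
positive relative size. -/
theorem exists_independent_selection (g : ι → A → ℝ) (a : ι → ℝ) {ε : ℝ} (hε : 0 < ε) :
    ∃ c : ℝ, 0 < c ∧ ∀ (α : Type u) [Fintype α] [Nonempty α] (ω : (α → ι) → α → A),
      (∀ σ, ∑ s, a (σ s) ≤ ∑ s, g (σ s) (ω σ s)) →
      ∃ p : ι → A, ∑ j, a j - ε ≤ ∑ j, g j (p j) ∧
        ∃ W : Finset α, c * Fintype.card α ≤ W.card ∧
          ∀ τ : α → ι, ∃ σ, ∀ s ∈ W, ω σ s = p (τ s) := by
  rcases isEmpty_or_nonempty ι with hι | hι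
  · refine ⟨1, one_pos, fun α _ _ ω _ => ⟨hι.elim, by simp [hε.le], Finset.univ, by simp,
      fun τ => hι.elim (τ (Classical.arbitrary α))⟩⟩
  -- Doubling the indices covers the case of a single index; of the two resulting selections one is
  -- at least as good as the average.
  obtain ⟨c, hc, h⟩ := exists_independent_selection_of_two_le.{u} (ι := ι × Bool)
    (by
      rw [Fintype.card_prod, Fintype.card_bool]
      have := Fintype.card_pos (α := ι)
      omega) (fun j => g j.1) (fun j => a j.1) (ε := 2 * ε) (by linarith)
  refine ⟨c, hc, fun α _ _ ω hω => ?_⟩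
  obtain ⟨p, hp, W, hW, hτ⟩ := h α (fun σ => ω fun s => (σ s).1) fun σ => hω fun s => (σ s).1
  simp only [Fintype.sum_prod_type_right, Fintype.sum_bool] at hp
  obtain ⟨b, hb⟩ : ∃ b, ∑ j, a j - ε ≤ ∑ j, g j (p (j, b)) := by
    by_contra! hlt
    linarith [hlt true, hlt false]
  refine ⟨fun j => p (j, b), hb, W, hW, fun τ => ?_⟩
  obtain ⟨σ, hσ⟩ := hτ fun s => (τ s, b)
  exact ⟨_, fun s hs => (hσ s hs).2⟩

end Selection

/-! ### Barycenters -/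

section Barycenter

variable {X : Type*} [TopologicalSpace X] [MeasurableSpace X] [BorelSpace X] [CompactSpace X]

theorem integrable_continuousMap (ν : ProbabilityMeasure X) (f : C(X, ℝ)) :
    Integrable f (ν : Measure X) :=
  f.continuous.integrable_of_hasCompactSupport (HasCompactSupport.of_compactSpace _)

theorem continuous_integral (f : C(X, ℝ)) :
    Continuous fun ν : ProbabilityMeasure X => ∫ x, f x ∂(ν : Measure X) :=
  continuous_iff_continuousAt.2 fun _ =>
    ProbabilityMeasure.tendsto_iff_forall_integral_tendsto.1 tendsto_id
      (BoundedContinuousFunction.mkOfCompact f)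

/-- The barycenter of `m` is its average, evaluated on Borel sets. -/
theorem IsBarycenter.measure_eq_lintegral [TopologicalSpace.MetrizableSpace X]
    {m : ProbabilityMeasure (ProbabilityMeasure X)} {μ : ProbabilityMeasure X}
    (h : IsBarycenter m μ) {D : Set X} (hD : MeasurableSet D) :
    (μ : Measure X) D = ∫⁻ ν, (ν : Measure X) D ∂(m : Measure (ProbabilityMeasure X)) := by
  let : MetricSpace X := TopologicalSpace.metrizableSpaceMetric X
  have hmeas : Measurable fun ν : ProbabilityMeasure X => (ν : Measure X) :=
    measurable_subtype_coe
  have key : (μ : Measure X) =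
      (m : Measure (ProbabilityMeasure X)).bind fun ν => (ν : Measure X) := by
    refine ext_of_forall_lintegral_eq_of_IsFiniteMeasure fun f => ?_
    let f' : C(X, ℝ) := ⟨fun x => (f x : ℝ), by fun_prop⟩
    have hf : ∀ ν : ProbabilityMeasure X,
        ∫⁻ x, f x ∂(ν : Measure X) = ENNReal.ofReal (∫ x, f' x ∂(ν : Measure X)) := by
      intro ν
      rw [ofReal_integral_eq_lintegral_ofReal (integrable_continuousMap ν f')
        (Eventually.of_forall fun x => NNReal.coe_nonneg _)]
      simp [f']
    rw [Measure.lintegral_bind hmeas.aemeasurable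
      f.continuous.measurable.coe_nnreal_ennreal.aemeasurable]
    simp only [hf]
    -- Evaluation at `f'` is one of the functionals tested in `IsBarycenter`.
    have hbar : ∫ ν, (∫ x, f' x ∂(ν : Measure X)) ∂(m : Measure (ProbabilityMeasure X)) =
        ∫ x, f' x ∂(μ : Measure X) := h (WeakBilin.eval (topDualPairing ℝ C(X, ℝ)) f')
    rw [← hbar, ofReal_integral_eq_lintegral_ofReal]
    · exact integrable_continuousMap m ⟨_, continuous_integral f'⟩
    · exact Eventually.of_forall fun ν => integral_nonneg fun x => NNReal.coe_nonneg _
  conv_lhs => rw [key]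
  exact Measure.bind_apply hD hmeas.aemeasurable

/-- Markov's inequality for the barycenter. -/
theorem IsBarycenter.measureReal_le [TopologicalSpace.MetrizableSpace X]
    {m : ProbabilityMeasure (ProbabilityMeasure X)} {μ : ProbabilityMeasure X}
    (h : IsBarycenter m μ) {D : Set X} (hD : MeasurableSet D) {η δ : ℝ} (hη : 0 < η)
    (hμ : (μ : Measure X).real D ≤ δ * η) :
    MeasurableSet {ν : ProbabilityMeasure X | (ν : Measure X).real D ≤ η} ∧
      1 - δ ≤ (m : Measure (ProbabilityMeasure X)).real
        {ν : ProbabilityMeasure X | (ν : Measure X).real D ≤ η} := by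
  have hmeas : Measurable fun ν : ProbabilityMeasure X => (ν : Measure X) D :=
    (Measure.measurable_coe hD).comp measurable_subtype_coe
  have hset : MeasurableSet {ν : ProbabilityMeasure X | (ν : Measure X).real D ≤ η} :=
    measurableSet_le hmeas.ennreal_toReal measurable_const
  refine ⟨hset, ?_⟩
  have hint : ∫ ν, (ν : Measure X).real D ∂(m : Measure (ProbabilityMeasure X)) =
      (μ : Measure X).real D := by
    rw [measureReal_def, h.measure_eq_lintegral hD]
    exact integral_toReal hmeas.aemeasurable (Eventually.of_forall fun ν => measure_lt_top _ _)
  have hi : Integrable (fun ν : ProbabilityMeasure X => (ν : Measure X).real D)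
      (m : Measure (ProbabilityMeasure X)) :=
    Integrable.of_bound hmeas.ennreal_toReal.aestronglyMeasurable 1
      (Eventually.of_forall fun ν => by
        rw [Real.norm_of_nonneg measureReal_nonneg]
        exact measureReal_le_one)
  have hM := mul_meas_ge_le_integral_of_nonneg
    (Eventually.of_forall fun ν : ProbabilityMeasure X => measureReal_nonneg (s := D)) hi η
  rw [hint] at hM
  have hcr : (m : Measure (ProbabilityMeasure X)).real
      {ν : ProbabilityMeasure X | (ν : Measure X).real D ≤ η}ᶜ ≤ δ := by
    refine (measureReal_mono (fun ν hν => ?_)).trans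
      (le_of_mul_le_mul_left (hM.trans (hμ.trans_eq (mul_comm _ _))) hη)
    exact (not_le.1 (show ¬ (ν : Measure X).real D ≤ η from hν)).le
  have := probReal_compl_eq_one_sub (μ := (m : Measure (ProbabilityMeasure X))) hset
  linarith

omit [TopologicalSpace X] [BorelSpace X] [CompactSpace X] in
/-- First moment method: finitely many functions with integrals bounded below have a common
point where their sum is large and which belongs to most of given sets with large measure. -/
theorem exists_sum_le_sum_sub_indicator {α : Type*} [Fintype α] (ν : Measure X)
    [IsProbabilityMeasure ν] (h : α → X → ℝ) (hi : ∀ s, Integrable (h s) ν) (b : α → ℝ)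
    (hb : ∀ s, b s ≤ ∫ x, h s x ∂ν) (D : α → Set X) (hD : ∀ s, MeasurableSet (D s))
    {η L : ℝ} (hL : 0 ≤ L) (hη : ∀ s, ν.real (D s) ≤ η) :
    ∃ x, ∑ s, (b s - L * η) ≤ ∑ s, (h s x - L * (D s).indicator 1 x) := by
  have hind : ∀ s, Integrable (fun x => L * (D s).indicator (1 : X → ℝ) x) ν := fun s =>
    (((integrable_const (1 : ℝ)).indicator (hD s)).const_mul L)
  have hint : Integrable (fun x => ∑ s, (h s x - L * (D s).indicator (1 : X → ℝ) x)) ν :=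
    integrable_finsetSum _ fun s _ => (hi s).sub (hind s)
  obtain ⟨x, hx⟩ := exists_integral_le hint
  refine ⟨x, le_trans ?_ hx⟩
  rw [integral_finsetSum (f := fun s x => h s x - L * (D s).indicator (1 : X → ℝ) x) _
    fun s _ => (hi s).sub (hind s)]
  refine Finset.sum_le_sum fun s _ => ?_
  rw [integral_sub (hi s) (hind s), integral_const_mul, integral_indicator_one (hD s)]
  have := mul_le_mul_of_nonneg_left (hη s) hL
  linarith [hb s]

end Barycenter

/-! ### From measures to points -/

section Independence

variable {Γ X : Type*} [Group Γ] [MetricSpace X] [CompactSpace X] [MeasurableSpace X]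
  [BorelSpace X] [MulAction Γ X] [ContinuousConstSMul Γ X] {k : ℕ}

/-- Independence of neighborhoods of probability measures yields independence, relative to the
barycenter, of tuples of small balls in the underlying space on which given functions are large. -/
theorem exists_isIndepSetRel_ball {m : ProbabilityMeasure (ProbabilityMeasure X)}
    {μ : ProbabilityMeasure X} (hμ : IsBarycenter m μ) (f : Fin k → C(X, ℝ)) (v : Fin k → ℝ)
    (hv : HasPosSeqIndepDensity Γ m fun j =>
      {ν : ProbabilityMeasure X | v j ≤ ∫ x, f j x ∂(ν : Measure X)})
    {ε r : ℝ} (hε : 0 < ε) (hr : ∀ j x y, dist x y < r → |f j x - f j y| < ε)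
    (t : Finset X) (ht : ∀ x, ∃ p ∈ t, dist x p < r) :
    ∃ δ : ℝ, 0 < δ ∧ ∃ c : ℝ, 0 < c ∧ ∀ M : ℝ, 0 < M →
      ∃ F : Finset Γ, F.Nonempty ∧ M ≤ (F.card : ℝ) ∧ ∀ D ∈ largeFamilies Γ μ δ,
        ∃ p : Fin k → X, (∀ j, p j ∈ t) ∧ ∑ j, v j - (2 * k + 1) * ε ≤ ∑ j, f j (p j) ∧
          ∃ J : Finset Γ, J ⊆ F ∧ IsIndepSetRel (fun j => Metric.ball (p j) r) D J ∧
            c * (F.card : ℝ) ≤ (J.card : ℝ) := by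
  classical
  obtain ⟨C, hC0, hC⟩ : ∃ C : ℝ, 0 < C ∧ ∀ j x, |f j x| ≤ C := by
    choose C hC using fun j => (isCompact_range (f j).continuous).isBounded.exists_norm_le
    refine ⟨∑ j, |C j| + 1, by positivity, fun j x => ?_⟩
    have h1 := (hC j _ (mem_range_self x)).trans (le_abs_self _)
    have h2 := Finset.single_le_sum (f := fun j => |C j|) (fun j _ => abs_nonneg _)
      (Finset.mem_univ j)
    rw [Real.norm_eq_abs] at h1
    linarith
  set V : ℝ := ∑ j, v j with hV
  -- The letter `none` (meaning `x ∉ D s`) gets value `-K`, too low for any near-optimal selection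
  -- even if all other letters have value `C`. The penalty `K + C` pushes any value `f ≤ C` below
  -- `-K`, and `η` makes its expected cost at most `ε`.
  set K : ℝ := k * C + |V| + (2 * k + 1) * ε + 1 with hK
  have hKC : 0 < K + C := by positivity
  set η : ℝ := ε / (K + C) with hη
  have hη0 : 0 < η := by positivity
  obtain ⟨δ, hδ, c₁, hc₁, hF⟩ := hv
  let g : Fin k → Option t → ℝ := fun j o => o.elim (-K) fun p => f j p
  -- One `ε` pays for the penalty, the other for moving to a net point.
  obtain ⟨c₀, hc₀, hsel⟩ := exists_independent_selection g (fun j => v j - 2 * ε) hε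
  refine ⟨δ * η, by positivity, c₀ * c₁, by positivity, fun M hM => ?_⟩
  obtain ⟨F, hFne, hFM, hFD⟩ := hF M hM
  refine ⟨F, hFne, hFM, fun D hD => ?_⟩
  have hE : ∀ s, (μ : Measure X).real (D s)ᶜ ≤ δ * η := fun s => by
    rw [probReal_compl_eq_one_sub (hD.1 s)]
    linarith [hD.2 s]
  obtain ⟨J, hJF, ⟨hJne, hJ⟩, hJc⟩ := hFD
    (fun s => {ν : ProbabilityMeasure X | (ν : Measure X).real (D s)ᶜ ≤ η})
    ⟨fun s => (hμ.measureReal_le (hD.1 s).compl hη0 (hE s)).1,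
      fun s => (hμ.measureReal_le (hD.1 s).compl hη0 (hE s)).2⟩
  have : Nonempty J := hJne.to_subtype
  have hx : ∀ σ : J → Fin k, ∃ x, ∑ s, (v (σ s) - (K + C) * η) ≤
      ∑ s : J, (f (σ s) ((s : Γ) • x) - (K + C) * ((D s)ᶜ).indicator 1 x) := by
    intro σ
    obtain ⟨ν, hν⟩ := hJ σ
    simp only [mem_iInter, mem_inter_iff, mem_preimage, mem_ofPred_eq] at hν
    refine exists_sum_le_sum_sub_indicator (ν : Measure X)
      (fun (s : J) x => f (σ s) ((s : Γ) • x)) (fun s => ?_) (fun s => v (σ s)) (fun s => ?_)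
      (fun s => (D s)ᶜ) (fun s => (hD.1 s).compl) hKC.le fun s => (hν s).1
    · exact integrable_continuousMap ν ⟨_, (f (σ s)).continuous.comp (continuous_const_smul _)⟩
    · refine (hν s).2.trans_eq ?_
      rw [coe_smul]
      exact integral_map (measurable_const_smul _).aemeasurable
        (f (σ s)).continuous.aestronglyMeasurable
  choose x hx using hx
  choose q hqt hq using ht
  obtain ⟨p, hp, W, hW, hWτ⟩ := hsel J
    (fun σ s => if x σ ∈ D s then some ⟨q ((s : Γ) • x σ), hqt _⟩ else none) fun σ => by
    have h1 : (K + C) * η = ε := by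
      rw [hη]
      field_simp
    calc ∑ s, (v (σ s) - 2 * ε) = ∑ s, (v (σ s) - (K + C) * η) - ∑ s : J, ε := by
          rw [← Finset.sum_sub_distrib, h1]
          exact Finset.sum_congr rfl fun s _ => by ring
      _ ≤ ∑ s : J, (f (σ s) ((s : Γ) • x σ) - (K + C) * ((D s)ᶜ).indicator 1 (x σ))
          - ∑ s : J, ε := sub_le_sub_right (hx σ) _
      _ ≤ _ := by
          rw [← Finset.sum_sub_distrib]
          refine Finset.sum_le_sum fun s _ => ?_
          by_cases hs : x σ ∈ D s
          · have := (abs_lt.1 (hr (σ s) _ _ (hq ((s : Γ) • x σ)))).2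
            simp only [hs, if_true, g, Option.elim, mem_compl_iff, not_true_eq_false,
              not_false_eq_true, indicator_of_notMem]
            linarith
          · have := (abs_le.1 (hC (σ s) ((s : Γ) • x σ))).2
            simp only [hs, if_false, g, Option.elim, mem_compl_iff, not_false_eq_true,
              indicator_of_mem, Pi.one_apply]
            linarith
  have hsum : ∑ j, (v j - 2 * ε) - ε = V - (2 * k + 1) * ε := by
    rw [Finset.sum_sub_distrib]
    simp only [Finset.sum_const, Finset.card_univ, Fintype.card_fin, nsmul_eq_mul]
    ring
  rw [hsum] at hp
  have hgC : ∀ j o, g j o ≤ C := by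
    rintro j (_ | o)
    · exact le_trans (neg_nonpos.2 (by positivity)) hC0.le
    · exact (abs_le.1 (hC j o)).2
  have hsome : ∀ j, ∃ y : t, p j = some y := by
    intro i
    by_contra! hnone
    have hi : p i = none := Option.eq_none_iff_forall_ne_some.2 hnone
    have h1 : ∑ j ∈ Finset.univ.erase i, g j (p j) ≤ k * C := by
      refine (Finset.sum_le_card_nsmul _ _ C fun j _ => hgC j _).trans ?_
      rw [nsmul_eq_mul]
      refine mul_le_mul_of_nonneg_right ?_ hC0.le
      exact_mod_cast (Finset.card_le_univ _).trans_eq (Fintype.card_fin k)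
    have h2 : g i (p i) = -K := by rw [hi]; rfl
    rw [← Finset.add_sum_erase _ _ (Finset.mem_univ i), h2] at hp
    linarith [neg_abs_le V]
  choose y hy using hsome
  have hJ0 : (0 : ℝ) < J.card := by exact_mod_cast hJne.card_pos
  rw [Fintype.card_coe] at hW
  refine ⟨fun j => y j, fun j => (y j).2, ?_, W.map (Function.Embedding.subtype _), ?_, ⟨?_, ?_⟩,
    ?_⟩
  · refine hp.trans_eq (Finset.sum_congr rfl fun j _ => ?_)
    rw [hy j]
    rfl
  · intro s hs
    obtain ⟨s, -, rfl⟩ := Finset.mem_map.1 hs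
    exact hJF s.2
  · rw [Finset.map_nonempty, ← Finset.card_pos]
    have : (0 : ℝ) < W.card := lt_of_lt_of_le (by positivity) hW
    exact_mod_cast this
  · intro τ
    rcases isEmpty_or_nonempty (Fin k) with hk | hk
    · have hW0 : (0 : ℝ) < W.card := lt_of_lt_of_le (by positivity) hW
      obtain ⟨s, hs⟩ := Finset.card_pos.1 (by exact_mod_cast hW0)
      exact hk.elim (τ ⟨_, Finset.mem_map_of_mem _ hs⟩)
    -- The pattern `τ` lives on `W` only; its values on the rest of `J` are irrelevant.
    obtain ⟨σ, hσ⟩ := hWτ fun s => if h : (s : Γ) ∈ W.map (Function.Embedding.subtype _) then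
      τ ⟨s, h⟩ else Classical.arbitrary _
    refine ⟨x σ, mem_iInter.2 ?_⟩
    rintro ⟨s, hs⟩
    obtain ⟨s, hsW, rfl⟩ := Finset.mem_map.1 hs
    have h1 := hσ s hsW
    rw [hy, dif_pos (show (s : Γ) ∈ _ from hs)] at h1
    split_ifs at h1 with h2
    refine ⟨h2, ?_⟩
    have h3 : q ((s : Γ) • x σ) = y (τ ⟨s, hs⟩) := congrArg Subtype.val (Option.some.inj h1)
    change dist ((s : Γ) • x σ) (y (τ ⟨s, hs⟩) : X) < r
    rw [← h3]
    exact hq _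
  · rw [Finset.card_map]
    have := mul_le_mul_of_nonneg_left hJc hc₀.le
    linarith

end Independence

/-! ### Localization to a single tuple and the key inequality -/

section Main

variable {Γ X : Type*} [Group Γ] [TopologicalSpace X] [CompactSpace X]
  [TopologicalSpace.MetrizableSpace X] [MeasurableSpace X] [BorelSpace X] [MulAction Γ X]
  [ContinuousConstSMul Γ X] {k : ℕ}

omit [Group Γ] in
theorem IsIndepSetRel.mono {Y : Type*} [SMul Γ Y] {A A' : Fin k → Set Y} {D D' : Γ → Set Y}
    {J : Finset Γ} (h : IsIndepSetRel A D J) (hA : ∀ j, A j ⊆ A' j) (hD : ∀ s, D s ⊆ D' s) :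
    IsIndepSetRel A' D' J :=
  ⟨h.1, fun σ => (h.2 σ).mono <| iInter_mono fun s =>
    inter_subset_inter (hD s) (preimage_mono (hA _))⟩

omit [Group Γ] in
/-- A positive density shared by finitely many tuples is possessed by one of them. -/
theorem exists_hasPosSeqIndepDensity_of_finite {Y β : Type*} [SMul Γ Y] [MeasurableSpace Y]
    [Finite β] (μ : ProbabilityMeasure Y) (A : β → Fin k → Set Y)
    (h : ∃ δ : ℝ, 0 < δ ∧ ∃ c : ℝ, 0 < c ∧ ∀ M : ℝ, 0 < M →
      ∃ F : Finset Γ, F.Nonempty ∧ M ≤ (F.card : ℝ) ∧ ∀ D ∈ largeFamilies Γ μ δ,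
        ∃ b, ∃ J : Finset Γ, J ⊆ F ∧ IsIndepSetRel (A b) D J ∧
            c * (F.card : ℝ) ≤ (J.card : ℝ)) :
    ∃ b, HasPosSeqIndepDensity Γ μ (A b) := by
  obtain ⟨δ, hδ, c, hc, hF⟩ := h
  by_contra! hno
  have := Fintype.ofFinite β
  -- If each `A b` fails with tolerance `δ / N`, intersecting the bad families loses less than `δ`
  -- in all; the added 1 keeps `N` positive when `β` is empty.
  set N : ℝ := Fintype.card β + 1
  have hN : 0 < N := by positivity
  have hno' : ∀ b, ∃ M : ℝ, 0 < M ∧ ∀ F : Finset Γ, F.Nonempty → M ≤ (F.card : ℝ) →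
      ∃ D ∈ largeFamilies Γ μ (δ / N), ∀ J : Finset Γ, J ⊆ F → IsIndepSetRel (A b) D J →
        ¬ c * (F.card : ℝ) ≤ (J.card : ℝ) := by
    intro b
    by_contra! hb
    exact hno b ⟨δ / N, by positivity, c, hc, hb⟩
  choose M hM hMF using hno'
  obtain ⟨F, hFne, hFM, hFD⟩ := hF (∑ b, M b + 1) (by
    have := Finset.sum_nonneg fun b (_ : b ∈ Finset.univ) => (hM b).le
    linarith)
  choose D hD hDJ using fun b => hMF b F hFne (by
    have := Finset.single_le_sum (fun b _ => (hM b).le) (Finset.mem_univ b)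
    linarith)
  obtain ⟨b, J, hJF, hJ, hJc⟩ := hFD (fun s => ⋂ b, D b s) ⟨fun s =>
    MeasurableSet.iInter fun b => (hD b).1 s, fun s => by
      have h1 := probReal_compl_eq_one_sub (μ := (μ : Measure Y))
        (MeasurableSet.iInter fun b => (hD b).1 s)
      have h2 : (μ : Measure Y).real (⋂ b, D b s)ᶜ ≤ ∑ b, (μ : Measure Y).real (D b s)ᶜ := by
        rw [compl_iInter]
        exact measureReal_iUnion_fintype_le _
      have h3 : ∑ b, (μ : Measure Y).real (D b s)ᶜ ≤ Fintype.card β * (δ / N) := by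
        rw [← nsmul_eq_mul, ← Finset.card_univ]
        refine Finset.sum_le_card_nsmul _ _ _ fun b _ => ?_
        rw [probReal_compl_eq_one_sub ((hD b).1 s)]
        linarith [(hD b).2 s]
      have h4 : N * (δ / N) = δ := by field_simp
      have h5 : 0 < δ / N := by positivity
      have h6 : Fintype.card β * (δ / N) = δ - δ / N := by
        rw [eq_sub_iff_add_eq, ← add_one_mul]
        exact h4
      linarith⟩
  exact hDJ b J hJF (hJ.mono (fun _ => subset_rfl) fun s => iInter_subset _ b) hJc

/-- Continuous functions which have large integrals with respect to the members of a measure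
IN-tuple of probability measures take large values at some measure IN-tuple of points, for the
barycenter. -/
theorem exists_mem_measureIN_le_sum {m : ProbabilityMeasure (ProbabilityMeasure X)}
    {μ : ProbabilityMeasure X} (hμ : IsBarycenter m μ) {ν : Fin k → ProbabilityMeasure X}
    (hν : ν ∈ measureIN Γ k m) (f : Fin k → C(X, ℝ)) {u : ℝ}
    (hu : u < ∑ j, ∫ x, f j x ∂(ν j : Measure X)) :
    ∃ y ∈ measureIN Γ k μ, u ≤ ∑ j, f j (y j) := by
  classical
  let : MetricSpace X := TopologicalSpace.metrizableSpaceMetric X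
  by_contra! hlt
  set I : Set (Fin k → X) := {y | u ≤ ∑ j, f j (y j)} with hI
  have hIc : IsCompact I := (isClosed_le continuous_const (by fun_prop)).isCompact
  have hno : ∀ y : I, ∃ U : Fin k → Set X, (∀ j, U j ∈ 𝓝 (y.1 j)) ∧
      ¬ HasPosSeqIndepDensity Γ μ U := by
    intro y
    by_contra! hy
    exact absurd (show u ≤ _ from y.2) (not_le.2 (hlt y.1 hy))
  choose U hU hUno using hno
  -- By contradiction every point of `I` has a box without positive density; small balls around
  -- points of `I` lie inside one such box.
  obtain ⟨r₁, hr₁, hr₁U⟩ := lebesgue_number_lemma_of_metric (s := I)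
    (c := fun y : I => Set.univ.pi fun j => interior (U y j)) hIc
    (fun y => isOpen_set_pi finite_univ fun j _ => isOpen_interior)
    (fun y hy => mem_iUnion.2 ⟨⟨y, hy⟩, fun j _ => mem_interior_iff_mem_nhds.2 (hU ⟨y, hy⟩ j)⟩)
  set V : ℝ := ∑ j, ∫ x, f j x ∂(ν j : Measure X) with hV
  -- Lowering each integral by `ε` costs `k * ε`, and passing to balls costs `(2 * k + 1) * ε`.
  set ε : ℝ := (V - u) / (3 * k + 1) with hε
  have hε0 : 0 < ε := div_pos (by linarith) (by positivity)
  have hεV : (3 * k + 1) * ε = V - u := by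
    rw [hε]
    field_simp
  obtain ⟨r, hr, hrr₁, hrf⟩ : ∃ r > 0, r ≤ r₁ ∧
      ∀ j x y, dist x y < r → |f j x - f j y| < ε := by
    have huc : ∀ j, ∃ δ > 0, ∀ x y, dist x y < δ → |f j x - f j y| < ε := fun j => by
      obtain ⟨δ, hδ, h⟩ := Metric.uniformContinuous_iff.1
        (CompactSpace.uniformContinuous_of_continuous (f j).continuous) ε hε0
      exact ⟨δ, hδ, fun x y hxy => h hxy⟩
    choose d hd hdf using huc
    obtain ⟨r, hr, hrd⟩ : ∃ r > 0, ∀ j, r ≤ d j := by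
      rcases isEmpty_or_nonempty (Fin k) with hk | hk
      · exact ⟨1, one_pos, fun j => hk.elim j⟩
      · obtain ⟨i, hi⟩ := Finite.exists_min d
        exact ⟨d i, hd i, hi⟩
    exact ⟨min r r₁, lt_min hr hr₁, min_le_right _ _, fun j x y hxy =>
      hdf j x y (hxy.trans_le ((min_le_left _ _).trans (hrd j)))⟩
  obtain ⟨t, -, htf, ht⟩ := finite_cover_balls_of_compact (isCompact_univ (X := X)) hr
  have htn : ∀ x, ∃ p ∈ htf.toFinset, dist x p < r := fun x => by
    obtain ⟨p, hp, hxp⟩ := mem_iUnion₂.1 (ht (mem_univ x))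
    exact ⟨p, htf.mem_toFinset.2 hp, hxp⟩
  have hdens : HasPosSeqIndepDensity Γ m fun j => {ν' : ProbabilityMeasure X |
      ∫ x, f j x ∂(ν j : Measure X) - ε ≤ ∫ x, f j x ∂(ν' : Measure X)} :=
    hν _ fun j => (continuous_integral (f j)).continuousAt.preimage_mem_nhds
      (Ici_mem_nhds (by linarith))
  obtain ⟨δ, hδ, c, hc, hF⟩ := exists_isIndepSetRel_ball hμ f _ hdens hε0 hrf _ htn
  obtain ⟨y, hy⟩ := exists_hasPosSeqIndepDensity_of_finite (Γ := Γ)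
    (β := {p : Fin k → htf.toFinset // u ≤ ∑ j, f j (p j)}) μ
    (fun p j => Metric.ball (p.1 j : X) r) ⟨δ, hδ, c, hc, fun M hM => by
      obtain ⟨F, hFne, hFM, hFD⟩ := hF M hM
      refine ⟨F, hFne, hFM, fun D hD => ?_⟩
      obtain ⟨p, hp, hps, h⟩ := hFD D hD
      refine ⟨⟨fun j => ⟨p j, hp j⟩, le_trans (le_of_eq ?_) hps⟩, h⟩
      rw [Finset.sum_sub_distrib, ← hV]
      simp only [Finset.sum_const, Finset.card_univ, Fintype.card_fin, nsmul_eq_mul]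
      linarith⟩
  obtain ⟨z, hz⟩ := hr₁U (fun j => (y.1 j : X)) y.2
  have hsub : ∀ j, Metric.ball (y.1 j : X) r ⊆ U z j := by
    intro j x hx
    have h1 : Function.update (fun j => (y.1 j : X)) j x ∈
        Metric.ball (fun j => (y.1 j : X)) r₁ := by
      rw [Metric.mem_ball, dist_pi_lt_iff hr₁]
      intro i
      by_cases hij : i = j
      · subst hij
        simpa using lt_of_lt_of_le hx hrr₁
      · simpa [Function.update_of_ne hij] using hr₁
    have h2 := hz h1 j (mem_univ j)
    rw [Function.update_self] at h2
    exact interior_subset h2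
  refine hUno z ?_
  obtain ⟨δ, hδ, c, hc, hF⟩ := hy
  refine ⟨δ, hδ, c, hc, fun M hM => ?_⟩
  obtain ⟨F, hFne, hFM, hFD⟩ := hF M hM
  refine ⟨F, hFne, hFM, fun D hD => ?_⟩
  obtain ⟨J, hJF, hJ, hJc⟩ := hFD D hD
  exact ⟨J, hJF, hJ.mono hsub fun _ => subset_rfl, hJc⟩

end Main

end MeasureIN

/-! ### Conclusion by Hahn–Banach separation and Urysohn functions -/

theorem theorem1p6 {Γ X : Type*} [Group Γ] [Countable Γ]
    [TopologicalSpace X] [CompactSpace X] [TopologicalSpace.MetrizableSpace X]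
    [MeasurableSpace X] [BorelSpace X] [MulAction Γ X] [ContinuousConstSMul Γ X]
    (m : ProbabilityMeasure (ProbabilityMeasure X))
    (hm : SMulInvariantMeasure Γ (ProbabilityMeasure X) (m : Measure (ProbabilityMeasure X)))
    (μ : ProbabilityMeasure X) (hμ : MeasureIN.IsBarycenter m μ)
    (k : ℕ) (hk : 0 < k) :
    MeasureIN.tupleToDual '' MeasureIN.measureIN Γ k m ⊆
        closedConvexHull ℝ
          (MeasureIN.tupleToDual '' (MeasureIN.diracTuple '' MeasureIN.measureIN Γ k μ)) ∧
      ∀ x : Fin k → X, MeasureIN.diracTuple x ∈ MeasureIN.measureIN Γ k m →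
        x ∈ MeasureIN.measureIN Γ k μ := by
  constructor
  · rintro _ ⟨ν, hν, rfl⟩
    have : LocallyConvexSpace ℝ (WeakDual ℝ C(X, ℝ)) :=
      inferInstanceAs (LocallyConvexSpace ℝ (WeakBilin (topDualPairing ℝ C(X, ℝ))))
    by_contra hnot
    obtain ⟨φ, u, hφ, hu⟩ := geometric_hahn_banach_closed_point (convex_closedConvexHull (𝕜 := ℝ))
      isClosed_closedConvexHull hnot
    -- Weak*-continuous functionals are evaluations, so the separating functional is given by a
    -- tuple of continuous functions.
    have hf : ∀ j, ∃ f : C(X, ℝ), ∀ w : WeakDual ℝ C(X, ℝ),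
        φ (ContinuousLinearMap.single ℝ (fun _ : Fin k => WeakDual ℝ C(X, ℝ)) j w) = w f := by
      intro j
      obtain ⟨f, hf⟩ := LinearMap.dualEmbedding_surjective (topDualPairing ℝ C(X, ℝ))
        (φ.comp (ContinuousLinearMap.single ℝ (fun _ : Fin k => WeakDual ℝ C(X, ℝ)) j))
      exact ⟨f, fun w => (DFunLike.congr_fun hf w).symm⟩
    choose f hf using hf
    have hφf : ∀ w : Fin k → WeakDual ℝ C(X, ℝ), φ w = ∑ j, w j (f j) := by
      intro w
      conv_lhs => rw [← Finset.univ_sum_single w]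
      rw [map_sum]
      exact Finset.sum_congr rfl fun j _ => hf j (w j)
    rw [hφf] at hu
    obtain ⟨y, hy, hle⟩ := MeasureIN.exists_mem_measureIN_le_sum hμ hν f hu
    refine absurd (hφ _ (subset_closedConvexHull ⟨_, ⟨y, hy, rfl⟩, rfl⟩)) (not_lt.2 ?_)
    rw [hφf]
    refine hle.trans_eq (Finset.sum_congr rfl fun j _ => ?_)
    exact (integral_dirac' _ _ (f j).continuous.stronglyMeasurable).symm
  · intro x hx U hU
    let : MetricSpace X := TopologicalSpace.metrizableSpaceMetric X
    have hf : ∀ j, ∃ f : C(X, ℝ), f (x j) = 1 ∧ (∀ y ∉ U j, f y = 0) ∧ ∀ y, f y ≤ 1 := by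
      intro j
      obtain ⟨f, hf0, hf1, hf⟩ := exists_continuous_zero_one_of_isClosed
        (isOpen_interior (s := U j)).isClosed_compl (isClosed_singleton (x := x j))
        (disjoint_singleton_right.2 fun h => h (mem_interior_iff_mem_nhds.2 (hU j)))
      exact ⟨f, hf1 rfl, fun y hy => hf0 fun h => hy (interior_subset h), fun y => (hf y).2⟩
    choose f hf1 hf0 hf using hf
    -- The sum at `x` is `k`, and any threshold strictly between `k - 1` and `k` works: as each `f j
    -- ≤ 1`, every `f j (y j)` is then positive, so `U j` is also a neighborhood of `y j`.
    obtain ⟨y, hy, hle⟩ := MeasureIN.exists_mem_measureIN_le_sum (u := k - 1 / 2) hμ hx f (by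
      have : ∀ j, ∫ z, f j z ∂(MeasureIN.diracTuple x j : Measure X) = 1 := fun j =>
        (integral_dirac' _ _ (f j).continuous.stronglyMeasurable).trans (hf1 j)
      simp only [this]
      simp)
    have hyU : ∀ j, {z | 0 < f j z} ∈ 𝓝 (y j) := by
      intro i
      refine (isOpen_lt continuous_const (f i).continuous).mem_nhds ?_
      have h1 : ∑ j ∈ Finset.univ.erase i, f j (y j) ≤ (k : ℝ) - 1 := by
        refine (Finset.sum_le_card_nsmul _ _ 1 fun j _ => hf j _).trans ?_
        rw [Finset.card_erase_of_mem (Finset.mem_univ i), Finset.card_univ, Fintype.card_fin,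
          nsmul_eq_mul, mul_one, Nat.cast_sub hk, Nat.cast_one]
      rw [← Finset.add_sum_erase _ _ (Finset.mem_univ i)] at hle
      change 0 < f i (y i)
      linarith
    refine hy U fun j => mem_of_superset (hyU j) fun z hz => ?_
    by_contra h
    exact absurd (hf0 j z h) (ne_of_gt hz)
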